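/- Let $F$ be a field of characteristic not $2$, and let $R$ be a finitely generated associative $F$-algebra, not necessarily unital, with an ($F$-linear) involution $*:R\to R$, i.e. $(ab)^*=b^*a^*$ and $(a^*)^*=a$ for all $a,b\in R$. Let $K=\{a\in R\mid a^*=-a\}$ be the space of skew-symmetric elements, which is a Lie algebra over $F$ under $[a,b]=ab-ba$, and let $[K,K]$ be the $F$-span of all $[a,b]$ with $a,b\in K$. Suppose that $R$ contains an idempotent $e$ such that $ee^*=e^*e=0$ and $ReR=R(1-e-e^*)R=R$, where $ReR$ denotes the $F$-span of all products $aeb$ and $R(1-e-e^*)R$ the $F$-span of all elements $ab-aeb-ae^*b$, with $a,b\in R$. Then the Lie algebra $[K,K]$ is finitely generated. -/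

import Mathlib

/-- The commutator Lie ring `R⁽⁻⁾` of a (not necessarily unital) associative ring:
`⁅a, b⁆ = a * b - b * a`. -/
instance (priority := 100) commutatorLieRing (R : Type*) [NonUnitalRing R] : LieRing R where
  bracket a b := a * b - b * a
  add_lie a b c := by
    change (a + b) * c - c * (a + b) = (a * c - c * a) + (b * c - c * b)
    rw [add_mul, mul_add]; abel
  lie_add a b c := by
    change a * (b + c) - (b + c) * a = (a * b - b * a) + (a * c - c * a)
    rw [add_mul, mul_add]; abel
  lie_self a := sub_self (a * a)
  leibniz_lie a b c := by
    change a * (b * c - c * b) - (b * c - c * b) * a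
      = ((a * b - b * a) * c - c * (a * b - b * a)) + (b * (a * c - c * a) - (a * c - c * a) * b)
    simp only [mul_sub, sub_mul, mul_assoc]; abel

theorem commutatorLieRing_lie {R : Type*} [NonUnitalRing R] (a b : R) :
    ⁅a, b⁆ = a * b - b * a := rfl

/-- The commutator Lie algebra `R⁽⁻⁾` of a (not necessarily unital) associative `F`-algebra. -/
instance (priority := 100) commutatorLieAlgebra (F R : Type*) [CommRing F] [NonUnitalRing R]
    [Module F R] [IsScalarTower F R R] [SMulCommClass F R R] : LieAlgebra F R where
  lie_smul c a b := by
    rw [commutatorLieRing_lie, commutatorLieRing_lie, mul_smul_comm, smul_mul_assoc, smul_sub]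

/-- The Lie subalgebra `K = {a ∈ R | a* = -a}` of `R⁽⁻⁾` of skew-symmetric elements. The star on
the scalars is trivial, so `StarModule F R` says that the involution of `R` is `F`-linear. -/
def skewLieSubalgebra (F R : Type*) [CommRing F] [StarRing F] [TrivialStar F]
    [NonUnitalRing R] [StarRing R] [Module F R] [IsScalarTower F R R] [SMulCommClass F R R]
    [StarModule F R] : LieSubalgebra F R where
  carrier := {a | star a = -a}
  zero_mem' := by simp
  add_mem' := by
    intro a b (ha : star a = -a) (hb : star b = -b)
    change star (a + b) = -(a + b)
    rw [star_add, ha, hb, neg_add]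
  smul_mem' := by
    intro c a (ha : star a = -a)
    change star (c • a) = -(c • a)
    rw [star_smul, star_trivial, ha, smul_neg]
  lie_mem' := by
    intro a b (ha : star a = -a) (hb : star b = -b)
    change star (a * b - b * a) = -(a * b - b * a)
    rw [star_sub, star_mul, star_mul, ha, hb, neg_mul_neg, neg_mul_neg, neg_sub]

/-- The derived Lie algebra `[L, L]`. -/
abbrev derivedLieIdeal (F L : Type*) [CommRing F] [LieRing L] [LieAlgebra F L] : LieIdeal F L :=
  ⁅(⊤ : LieIdeal F L), (⊤ : LieIdeal F L)⁆

/-- A Lie algebra is finitely generated if some finite subset is contained in no proper Lie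
subalgebra. -/
def IsFinGenLieAlgebra (F L : Type*) [CommRing F] [LieRing L] [LieAlgebra F L] : Prop :=
  ∃ S : Finset L, LieSubalgebra.lieSpan F L (S : Set L) = ⊤

/-- A (not necessarily unital) associative algebra is finitely generated if some finite subset is
contained in no proper (not necessarily unital) subalgebra. -/
def IsFinGenAlgebra (F R : Type*) [CommRing F] [NonUnitalRing R] [Module F R]
    [IsScalarTower F R R] [SMulCommClass F R R] : Prop :=
  ∃ S : Finset R, NonUnitalAlgebra.adjoin F (S : Set R) = ⊤

/-! Write f = 1 - e - e* (formally), s(a) = a - a*, V = eRf and W = e*Rf. No generating set is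
written down. Let Λ run over the Lie subalgebras generated by finite subsets of [K,K]. Any finite
set of brackets lies in Λ once the finite subset is large enough, so finitely many conditions can be
imposed as they arise.

It suffices that some Λ contains s(V) and s(W), since then [K,K] ⊆ Λ (`lie_mem_of_half_le`). Indeed,
let Λ₀ be the Lie algebra generated by s(V) and s(W). Then K = Λ₀ + s(eRe) = Λ₀ + s(fRf), because
[s(v), s(y)] = s(y*v) - s(vy*) trades one diagonal block for the other. Both blocks normalize Λ₀ and
they commute with each other, so [K,K] ⊆ Λ₀.

To reach s(V), let V' be the set of v in V with s(v) in Λ. The module V is finitely generated over a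
finitely generated subalgebra of eRe (`exists_finite_generators`), but a single element of eRe need
not preserve V'. What does preserve V', for large Λ, are given commutators in eRe and given products
mn with m in eRe*, n in e*Re both symmetric or both skew. Combining these, ab·mn sends v into V' as
soon as v, av, bv are in V' (`eventually_mul_mul_corner_mul_mem`), so a long word carrying such a
factor is controlled by shorter ones.

If m and n have different parities, the square (mn)² = (mnm)n still works. Fullness of e* gives e =
u₁ + ... + uᵣ with each uᵢ = mᵢnᵢ homogeneous (`exists_sum_homogeneous`). Expanding e = e^(r+1),
each word has a repeated letter, and letters may be swapped modulo V' until a square appears. Hence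
the v whose multiples by words of bounded length all lie in V' form a submodule stable under the
generators, which is therefore all of V (`eventually_half_le`). Applying this to e* as well gives
s(W). -/

set_option linter.unusedSectionVars false

/-! ### Peirce components and brackets of their skew parts. -/

section SkewPeirce

variable {F : Type*} [Field F] [StarRing F] [TrivialStar F]
  {R : Type*} [NonUnitalRing R] [StarRing R] [Module F R] [IsScalarTower F R R]
  [SMulCommClass F R R] [StarModule F R]

/-- The linear map `a ↦ a - a*`. -/
def skewMap (F R : Type*) [Field F] [StarRing F] [TrivialStar F] [NonUnitalRing R] [StarRing R]
    [Module F R] [StarModule F R] : R →ₗ[F] R where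
  toFun a := a - star a
  map_add' a b := by rw [star_add]; abel
  map_smul' c a := by simp [smul_sub]

@[simp] theorem skewMap_apply (a : R) : skewMap F R a = a - star a := rfl

theorem star_skewMap (a : R) : star (skewMap F R a) = -skewMap F R a := by simp

theorem skewMap_star (a : R) : skewMap F R (star a) = -skewMap F R a := by simp

/-- The Peirce component `p R q`. -/
def peirceCorner (F : Type*) {R : Type*} [Field F] [NonUnitalRing R] [Module F R]
    [IsScalarTower F R R] [SMulCommClass F R R] (p q : R) : Submodule F R where
  carrier := {x | p * x = x ∧ x * q = x}
  zero_mem' := by simp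
  add_mem' := by
    rintro a b ⟨h1, h2⟩ ⟨h3, h4⟩
    exact ⟨by rw [mul_add, h1, h3], by rw [add_mul, h2, h4]⟩
  smul_mem' := by
    rintro c a ⟨h1, h2⟩
    exact ⟨by rw [mul_smul_comm, h1], by rw [smul_mul_assoc, h2]⟩

/-- The Peirce component `e R (1 - e - e*)`. -/
def peirceHalf (F : Type*) {R : Type*} [Field F] [NonUnitalRing R] [StarRing R] [Module F R]
    [IsScalarTower F R R] [SMulCommClass F R R] (e : R) : Submodule F R where
  carrier := {v | e * v = v ∧ v * e = 0 ∧ v * star e = 0}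
  zero_mem' := by simp
  add_mem' := by
    rintro a b ⟨h1, h2, h3⟩ ⟨h4, h5, h6⟩
    exact ⟨by rw [mul_add, h1, h4], by rw [add_mul, h2, h5, add_zero],
      by rw [add_mul, h3, h6, add_zero]⟩
  smul_mem' := by
    rintro c a ⟨h1, h2, h3⟩
    exact ⟨by rw [mul_smul_comm, h1], by rw [smul_mul_assoc, h2, smul_zero],
      by rw [smul_mul_assoc, h3, smul_zero]⟩

theorem peirceCorner_mul {p q r x y : R} (hx : x ∈ peirceCorner F p q)
    (hy : y ∈ peirceCorner F q r) : x * y ∈ peirceCorner F p r :=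
  ⟨by rw [← mul_assoc, hx.1], by rw [mul_assoc, hy.2]⟩

theorem star_mem_peirceCorner {p q x : R} (hx : x ∈ peirceCorner F p q) :
    star x ∈ peirceCorner F (star q) (star p) :=
  ⟨by rw [← star_mul, hx.2], by rw [← star_mul, hx.1]⟩

theorem corner_mul_half {e a v : R} (ha : a ∈ peirceCorner F e e) (hv : v ∈ peirceHalf F e) :
    a * v ∈ peirceHalf F e :=
  ⟨by rw [← mul_assoc, ha.1], by rw [mul_assoc, hv.2.1, mul_zero],
    by rw [mul_assoc, hv.2.2, mul_zero]⟩

theorem corner_mul_half_star {e m y : R} (hm : m ∈ peirceCorner F e (star e))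
    (hy : y ∈ peirceHalf F (star e)) : m * y ∈ peirceHalf F e := by
  obtain ⟨-, h2, h3⟩ := hy
  rw [star_star] at h3
  exact ⟨by rw [← mul_assoc, hm.1], by rw [mul_assoc, h3, mul_zero],
    by rw [mul_assoc, h2, mul_zero]⟩

theorem mul_eq_zero_of_absorb {p x y : R} (hx : x * p = x) (hy : p * y = 0) : x * y = 0 := by
  rw [← hx, mul_assoc, hy, mul_zero]

theorem mul_eq_zero_of_absorb' {p x y : R} (hx : x * p = 0) (hy : p * y = y) : x * y = 0 := by
  rw [← hy, ← mul_assoc, hx, zero_mul]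

/-- An idempotent `e` with `e e* = e* e = 0` and `R e R = R (1 - e - e*) R = R`. -/
structure IsFullSkewIdempotent (F : Type*) {R : Type*} [Field F] [NonUnitalRing R] [StarRing R]
    [Module F R] [IsScalarTower F R R] [SMulCommClass F R R] (e : R) : Prop where
  idem : e * e = e
  mul_star_self : e * star e = 0
  star_mul_self : star e * e = 0
  full : Submodule.span F {x : R | ∃ a b : R, x = a * e * b} = ⊤
  cofull : Submodule.span F {x : R | ∃ a b : R, x = a * b - a * e * b - a * star e * b} = ⊤

namespace IsFullSkewIdempotent

variable {e : R}

theorem star_idem (h : IsFullSkewIdempotent F e) : star e * star e = star e := by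
  rw [← star_mul, h.idem]

theorem star_full (h : IsFullSkewIdempotent F e) :
    Submodule.span F {x : R | ∃ a b : R, x = a * star e * b} = ⊤ := by
  rw [eq_top_iff]
  intro x _
  have key : ∀ y : R, star y ∈ Submodule.span F {x : R | ∃ a b : R, x = a * star e * b} := by
    intro y
    have hy : y ∈ Submodule.span F {x : R | ∃ a b : R, x = a * e * b} := by
      rw [h.full]; trivial
    induction hy using Submodule.span_induction with
    | mem z hz =>
      obtain ⟨a, b, rfl⟩ := hz
      exact Submodule.subset_span ⟨star b, star a, by simp [mul_assoc]⟩
    | zero => simp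
    | add y z _ _ hy hz => rw [star_add]; exact add_mem hy hz
    | smul c y _ hy => rw [star_smul, star_trivial c]; exact Submodule.smul_mem _ _ hy
  simpa using key (star x)

/-- The hypotheses are symmetric in e and e*, so every result about e R (1 - e - e*) also serves for
e* R (1 - e - e*). -/
theorem conj (h : IsFullSkewIdempotent F e) : IsFullSkewIdempotent F (star e) where
  idem := h.star_idem
  mul_star_self := by rw [star_star]; exact h.star_mul_self
  star_mul_self := by rw [star_star]; exact h.mul_star_self
  full := h.star_full
  cofull := by
    rw [← h.cofull]
    congr 1
    ext x
    refine exists_congr fun a => exists_congr fun b => ?_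
    rw [star_star, sub_right_comm]

theorem mem_corner (h : IsFullSkewIdempotent F e) : e ∈ peirceCorner F e e := ⟨h.idem, h.idem⟩

variable (F) in
theorem induction_full (h : IsFullSkewIdempotent F e) {P : R → Prop}
    (mem : ∀ a b, P (a * e * b)) (zero : P 0) (add : ∀ x y, P x → P y → P (x + y))
    (smul : ∀ (c : F) x, P x → P (c • x)) (x : R) : P x := by
  have hx : x ∈ Submodule.span F {x : R | ∃ a b : R, x = a * e * b} := by
    rw [h.full]; trivial
  induction hx using Submodule.span_induction with
  | mem z hz => obtain ⟨a, b, rfl⟩ := hz; exact mem a b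
  | zero => exact zero
  | add y z _ _ hy hz => exact add y z hy hz
  | smul c y _ hy => exact smul c y hy

variable (F) in
theorem induction_cofull (h : IsFullSkewIdempotent F e) {P : R → Prop}
    (mem : ∀ a b, P (a * b - a * e * b - a * star e * b)) (zero : P 0)
    (add : ∀ x y, P x → P y → P (x + y))
    (smul : ∀ (c : F) x, P x → P (c • x)) (x : R) : P x := by
  have hx : x ∈ Submodule.span F
      {x : R | ∃ a b : R, x = a * b - a * e * b - a * star e * b} := by
    rw [h.cofull]; trivial
  induction hx using Submodule.span_induction with
  | mem z hz => obtain ⟨a, b, rfl⟩ := hz; exact mem a b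
  | zero => exact zero
  | add y z _ _ hy hz => exact add y z hy hz
  | smul c y _ hy => exact smul c y hy

theorem half_star_eq (h : IsFullSkewIdempotent F e) {v : R} (hv : v ∈ peirceHalf F e) :
    star v * star e = star v ∧ e * star v = 0 ∧
      star e * star v = 0 ∧ star e * v = 0 ∧ star v * e = 0 := by
  obtain ⟨h1, h2, h3⟩ := hv
  have h5 := mul_eq_zero_of_absorb' h.star_mul_self h1
  refine ⟨?_, ?_, ?_, h5, ?_⟩
  · rw [← star_mul, h1]
  · have := congrArg star h3
    simpa using this
  · have := congrArg star h2
    simpa using this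
  · have := congrArg star h5
    simpa using this

theorem lie_corner_half (h : IsFullSkewIdempotent F e) {a v : R} (ha : a ∈ peirceCorner F e e)
    (hv : v ∈ peirceHalf F e) :
    ⁅skewMap F R a, skewMap F R v⁆ = skewMap F R (a * v) := by
  obtain ⟨h1, h2, h3, h4, h5⟩ := h.half_star_eq hv
  obtain ⟨v1, v2, v3⟩ := hv
  have sa := star_mem_peirceCorner ha
  have z1 : a * star v = 0 := mul_eq_zero_of_absorb ha.2 h2
  have z2 : star a * v = 0 := mul_eq_zero_of_absorb sa.2 h4
  have z3 : star a * star v = 0 := mul_eq_zero_of_absorb sa.2 h3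
  have z4 : v * a = 0 := mul_eq_zero_of_absorb' v2 ha.1
  have z5 : v * star a = 0 := mul_eq_zero_of_absorb' v3 sa.1
  have z6 : star v * a = 0 := mul_eq_zero_of_absorb' h5 ha.1
  simp only [commutatorLieRing_lie, skewMap_apply, mul_sub, sub_mul, z1, z2, z3, z4, z5, z6,
    star_mul]
  abel

theorem lie_corner_corner (h : IsFullSkewIdempotent F e) {a b : R} (ha : a ∈ peirceCorner F e e)
    (hb : b ∈ peirceCorner F e e) :
    ⁅skewMap F R a, skewMap F R b⁆ = skewMap F R (a * b - b * a) := by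
  have sa := star_mem_peirceCorner ha
  have sb := star_mem_peirceCorner hb
  have z {x y : R} (hx : x ∈ peirceCorner F e e)
      (hy : y ∈ peirceCorner F (star e) (star e)) : x * y = 0 ∧ y * x = 0 :=
    ⟨mul_eq_zero_of_absorb hx.2 (mul_eq_zero_of_absorb' h.mul_star_self hy.1),
      mul_eq_zero_of_absorb hy.2 (mul_eq_zero_of_absorb' h.star_mul_self hx.1)⟩
  simp only [commutatorLieRing_lie, skewMap_apply, mul_sub, sub_mul, (z ha sb).1, (z ha sb).2,
    (z hb sa).1, (z hb sa).2, star_mul, star_sub]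
  abel

end IsFullSkewIdempotent

theorem lie_skewMap_of_mul_eq_zero {a y : R} (h1 : a * y = 0) (h2 : y * a = 0) :
    ⁅skewMap F R a, skewMap F R y⁆ = skewMap F R (star y * a) - skewMap F R (a * star y) := by
  have h3 : star y * star a = 0 := by rw [← star_mul, h1, star_zero]
  have h4 : star a * star y = 0 := by rw [← star_mul, h2, star_zero]
  simp only [commutatorLieRing_lie, skewMap_apply, mul_sub, sub_mul, h1, h2, h3, h4, star_mul,
    star_star]
  abel

namespace IsFullSkewIdempotent

variable {e : R}

theorem mul_half_half (h : IsFullSkewIdempotent F e) {a c : R} (ha : a ∈ peirceHalf F e)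
    (hc : c ∈ peirceHalf F e) : a * c = 0 ∧ star a * c = 0 :=
  ⟨mul_eq_zero_of_absorb' ha.2.1 hc.1,
    mul_eq_zero_of_absorb' (h.half_star_eq ha).2.2.2.2 hc.1⟩

theorem mul_half_half_star {a y : R} (ha : a ∈ peirceHalf F e)
    (hy : y ∈ peirceHalf F (star e)) : a * y = 0 ∧ y * a = 0 :=
  ⟨mul_eq_zero_of_absorb' ha.2.2 hy.1,
    mul_eq_zero_of_absorb' (by simpa using hy.2.2) ha.1⟩

theorem half_mul_star_half_star (h : IsFullSkewIdempotent F e) {a y : R}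
    (ha : a ∈ peirceHalf F e) (hy : y ∈ peirceHalf F (star e)) :
    a * star y ∈ peirceCorner F e e := by
  have := (h.conj.half_star_eq hy).1
  rw [star_star] at this
  exact ⟨by rw [← mul_assoc, ha.1], by rw [mul_assoc, this]⟩

theorem half_mul_star_half (h : IsFullSkewIdempotent F e) {a c : R}
    (ha : a ∈ peirceHalf F e) (hc : c ∈ peirceHalf F e) :
    a * star c ∈ peirceCorner F e (star e) :=
  ⟨by rw [← mul_assoc, ha.1], by rw [mul_assoc, (h.half_star_eq hc).1]⟩

theorem lie_half_half (h : IsFullSkewIdempotent F e) {a c : R}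
    (ha : a ∈ peirceHalf F e) (hc : c ∈ peirceHalf F e) :
    ⁅skewMap F R a, skewMap F R c⁆ = -skewMap F R (a * star c) := by
  rw [lie_skewMap_of_mul_eq_zero (h.mul_half_half ha hc).1 (h.mul_half_half hc ha).1,
    (h.mul_half_half hc ha).2, map_zero, zero_sub]

/-- This triple product stays in the half component, so it lets `Λ` act on it without knowing any
skew part from the corner e R e. -/
theorem lie_lie_half (h : IsFullSkewIdempotent F e) {a c y : R}
    (ha : a ∈ peirceHalf F e) (hc : c ∈ peirceHalf F e) (hy : y ∈ peirceHalf F (star e)) :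
    ⁅⁅skewMap F R a, skewMap F R y⁆, skewMap F R c⁆ = -skewMap F R
      (a * star y * c + c * star y * a - c * star a * y) := by
  have z1 : star y * a * c = 0 := by rw [mul_assoc, (h.mul_half_half ha hc).1, mul_zero]
  have z2 : star c * (star y * a) = 0 := by
    refine mul_eq_zero_of_absorb (h.half_star_eq hc).1 ?_
    have := (h.conj.half_star_eq hy).2.1
    rw [← mul_assoc, this, zero_mul]
  have z3 : star a * y * c = 0 := by
    rw [mul_assoc, (mul_half_half_star hc hy).2, mul_zero]
  have z4 : star c * (star a * y) = 0 := by
    rw [← mul_assoc, ← star_mul, (h.mul_half_half ha hc).1, star_zero, zero_mul]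
  have key : ⁅skewMap F R (star y * a), skewMap F R c⁆ =
      skewMap F R (c * star a * y) - skewMap F R (c * star y * a) := by
    simp only [commutatorLieRing_lie, skewMap_apply, mul_sub, sub_mul, z1, z3,
      star_mul, star_star, ← mul_assoc]
    simp only [← mul_assoc] at z2 z4
    rw [z2, z4]
    abel
  rw [lie_skewMap_of_mul_eq_zero (mul_half_half_star ha hy).1 (mul_half_half_star ha hy).2,
    sub_lie, h.lie_corner_half (h.half_mul_star_half_star ha hy) hc, key]
  simp only [map_sub, map_add]
  abel

end IsFullSkewIdempotent

end SkewPeirce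

/-! ### Operators that preserve the trace of `Λ` on e R (1 - e - e*). -/

section Eventual

open Filter

variable {F : Type*} [Field F] [StarRing F] [TrivialStar F]
  {R : Type*} [NonUnitalRing R] [StarRing R] [Module F R] [IsScalarTower F R R]
  [SMulCommClass F R R] [StarModule F R]

/-- The elements `v` of `e R (1 - e - e*)` with `v - v*` in the Lie subalgebra `Λ`. -/
def halfTrace (Λ : LieSubalgebra F R) (e : R) : Submodule F R :=
  peirceHalf F e ⊓ Λ.toSubmodule.comap (skewMap F R)

/-- Every commutator of two skew-symmetric elements lies in `Λ j` for `j` large enough. -/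
def EventuallyContainsBrackets {ι : Type*} (l : Filter ι) (Λ : ι → LieSubalgebra F R) : Prop :=
  ∀ x y : R, star x = -x → star y = -y → ∀ᶠ j in l, ⁅x, y⁆ ∈ Λ j

namespace IsFullSkewIdempotent

variable {e : R}

theorem triple_mem_halfTrace (h : IsFullSkewIdempotent F e) {Λ : LieSubalgebra F R} {a c y : R}
    (ha : a ∈ halfTrace Λ e) (hc : c ∈ halfTrace Λ e) (hy : y ∈ halfTrace Λ (star e)) :
    a * star y * c + c * star y * a - c * star a * y ∈ halfTrace Λ e := by
  refine ⟨sub_mem (add_mem ?_ ?_) ?_, ?_⟩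
  · exact corner_mul_half (h.half_mul_star_half_star ha.1 hy.1) hc.1
  · exact corner_mul_half (h.half_mul_star_half_star hc.1 hy.1) ha.1
  · exact corner_mul_half_star (h.half_mul_star_half hc.1 ha.1) hy.1
  · have := Λ.lie_mem (Λ.lie_mem ha.2 hy.2) hc.2
    rw [h.lie_lie_half ha.1 hc.1 hy.1] at this
    exact (Submodule.neg_mem_iff Λ.toSubmodule).1 this

theorem mul_mem_halfTrace (h : IsFullSkewIdempotent F e) {Λ : LieSubalgebra F R} {a v : R}
    (ha : a ∈ peirceCorner F e e) (ha' : skewMap F R a ∈ Λ) (hv : v ∈ halfTrace Λ e) :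
    a * v ∈ halfTrace Λ e := by
  refine ⟨corner_mul_half ha hv.1, ?_⟩
  have := Λ.lie_mem ha' hv.2
  rwa [h.lie_corner_half ha hv.1] at this

/-- Add the triple products of (a, c, nd) and (d, c, na). The terms beginning with c cancel because
n is symmetric. -/
theorem symm_mul_mem_halfTrace (h : IsFullSkewIdempotent F e) {Λ : LieSubalgebra F R}
    {a c d n : R} (ha : a ∈ halfTrace Λ e) (hd : d ∈ halfTrace Λ e) (hc : c ∈ halfTrace Λ e)
    (hn : star n = n) (hna : n * a ∈ halfTrace Λ (star e)) (hnd : n * d ∈ halfTrace Λ (star e)) :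
    (a * star d + d * star a) * n * c ∈ halfTrace Λ e := by
  have h1 := add_mem (h.triple_mem_halfTrace ha hc hnd) (h.triple_mem_halfTrace hd hc hna)
  convert h1 using 1
  simp only [star_mul, hn, add_mul, mul_assoc]
  abel

variable {ι : Type*} {l : Filter ι} {Λ : ι → LieSubalgebra F R}

/-- Since ev = v, the skew part of v is itself the bracket of the skew parts of e and v. -/
theorem eventually_mem_halfTrace (h : IsFullSkewIdempotent F e)
    (hl : EventuallyContainsBrackets l Λ) {v : R} (hv : v ∈ peirceHalf F e) :
    ∀ᶠ j in l, v ∈ halfTrace (Λ j) e := by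
  filter_upwards [hl (skewMap F R e) (skewMap F R v) (star_skewMap e) (star_skewMap v)] with j hj
  rw [h.lie_corner_half h.mem_corner hv, hv.1] at hj
  exact ⟨hv, hj⟩

/-- The threshold depends on a and b but not on v. This uniformity, kept in the later statements, is
what makes an induction over an infinite-dimensional module possible. -/
theorem eventually_commutator_mul_mem (h : IsFullSkewIdempotent F e)
    (hl : EventuallyContainsBrackets l Λ) {a b : R} (ha : a ∈ peirceCorner F e e)
    (hb : b ∈ peirceCorner F e e) :
    ∀ᶠ j in l, ∀ v ∈ halfTrace (Λ j) e, (a * b - b * a) * v ∈ halfTrace (Λ j) e := by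
  filter_upwards [hl (skewMap F R a) (skewMap F R b) (star_skewMap a) (star_skewMap b)]
    with j hj v hv
  rw [h.lie_corner_corner ha hb] at hj
  exact h.mul_mem_halfTrace (sub_mem (peirceCorner_mul ha hb) (peirceCorner_mul hb ha)) hj hv

/-- For skew m and n, nm = (mn)*, so the bracket of m and n is the skew part of mn. -/
theorem eventually_skew_mul_skew_mul_mem (h : IsFullSkewIdempotent F e)
    (hl : EventuallyContainsBrackets l Λ) {m n : R} (hm : m ∈ peirceCorner F e (star e))
    (hn : n ∈ peirceCorner F (star e) e) (hm' : star m = -m) (hn' : star n = -n) :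
    ∀ᶠ j in l, ∀ v ∈ halfTrace (Λ j) e, m * n * v ∈ halfTrace (Λ j) e := by
  filter_upwards [hl m n hm' hn'] with j hj v hv
  refine h.mul_mem_halfTrace (peirceCorner_mul hm hn) ?_ hv
  rwa [skewMap_apply, star_mul, hm', hn', neg_mul_neg]

theorem mem_half_of_mul (h : IsFullSkewIdempotent F e) (b : R) :
    e * b - e * b * e - e * b * star e ∈ peirceHalf F e := by
  have h1 := h.idem
  have h2 := h.star_idem
  have h3 := h.mul_star_self
  have h4 := h.star_mul_self
  refine ⟨?_, ?_, ?_⟩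
  · simp only [mul_sub, ← mul_assoc, h1]
  · simp only [sub_mul, mul_assoc, h1, h4, mul_zero, sub_self]
  · simp only [sub_mul, mul_assoc, h2, h3, mul_zero, sub_self, sub_zero]

theorem mul_cofull_mul_star (h : IsFullSkewIdempotent F e) (a b : R) :
    e * (a * b - a * e * b - a * star e * b) * star e =
      (e * a - e * a * e - e * a * star e) *
        star (e * star b - e * star b * e - e * star b * star e) := by
  have i1 : ∀ z, e * (e * z) = e * z := fun z => by rw [← mul_assoc, h.idem]
  have i2 : ∀ z, star e * (star e * z) = star e * z := fun z => by rw [← mul_assoc, h.star_idem]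
  have i3 : ∀ z, e * (star e * z) = 0 := fun z => by rw [← mul_assoc, h.mul_star_self, zero_mul]
  have i4 : ∀ z, star e * (e * z) = 0 := fun z => by rw [← mul_assoc, h.star_mul_self, zero_mul]
  simp only [star_sub, star_mul, star_star, mul_sub, sub_mul, mul_assoc, i1, i2, i3, i4, mul_zero]
  abel

theorem star_corner_mul_half {n v : R}
    (hn : n ∈ peirceCorner F (star e) e) (hv : v ∈ peirceHalf F e) :
    n * v ∈ peirceHalf F (star e) := by
  have := corner_mul_half_star (F := F) (e := star e) (m := n) (y := v)
  rw [star_star] at this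
  exact this hn hv

/-- Here [m, n] is not the skew part of mn. Instead, R(1 - e - e*)R = R makes 2m = m + m* a sum of
terms ad* + da* with a, d in the half component, and `symm_mul_mem_halfTrace` handles each term. -/
theorem eventually_symm_mul_symm_mul_mem (h : IsFullSkewIdempotent F e) (h2 : (2 : F) ≠ 0)
    (hl : EventuallyContainsBrackets l Λ) {m n : R} (hm : m ∈ peirceCorner F e (star e))
    (hn : n ∈ peirceCorner F (star e) e) (hm' : star m = m) (hn' : star n = n) :
    ∀ᶠ j in l, ∀ v ∈ halfTrace (Λ j) e, m * n * v ∈ halfTrace (Λ j) e := by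
  have key : ∀ x : R, ∀ᶠ j in l, ∀ v ∈ halfTrace (Λ j) e,
      (e * x * star e + e * star x * star e) * n * v ∈ halfTrace (Λ j) e := by
    intro x
    induction x using h.induction_cofull F with
    | mem a b =>
      set a' := e * a - e * a * e - e * a * star e
      set d' := e * star b - e * star b * e - e * star b * star e
      have ha' : a' ∈ peirceHalf F e := h.mem_half_of_mul a
      have hd' : d' ∈ peirceHalf F e := h.mem_half_of_mul (star b)
      filter_upwards [h.eventually_mem_halfTrace hl ha', h.eventually_mem_halfTrace hl hd',
        h.conj.eventually_mem_halfTrace hl (star_corner_mul_half hn ha'),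
        h.conj.eventually_mem_halfTrace hl (star_corner_mul_half hn hd')] with j h1 h2 h3 h4 v hv
      have := h.symm_mul_mem_halfTrace h1 h2 hv hn' h3 h4
      have e1 : e * (a * b - a * e * b - a * star e * b) * star e = a' * star d' :=
        h.mul_cofull_mul_star a b
      have e2 : e * star (a * b - a * e * b - a * star e * b) * star e = d' * star a' := by
        have := congrArg star e1
        simpa [mul_assoc] using this
      rwa [e1, e2]
    | zero => simp
    | add x y hx hy =>
      filter_upwards [hx, hy] with j h1 h2 v hv
      convert add_mem (h1 v hv) (h2 v hv) using 1
      simp only [star_add, mul_add, add_mul]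
      abel
    | smul c x hx =>
      filter_upwards [hx] with j h1 v hv
      convert Submodule.smul_mem _ c (h1 v hv) using 1
      simp only [star_smul, star_trivial c, mul_smul_comm, smul_mul_assoc, smul_add, add_mul]
  filter_upwards [key m] with j hj v hv
  have := Submodule.smul_mem _ (2 : F)⁻¹ (hj v hv)
  rw [hm', hm.1, hm.2, ← two_smul F m, smul_mul_assoc, smul_mul_assoc, smul_smul,
    inv_mul_cancel₀ h2, one_smul] at this
  exact this

theorem eventually_corner_mul_corner_mul_mem (h : IsFullSkewIdempotent F e) (h2 : (2 : F) ≠ 0)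
    (hl : EventuallyContainsBrackets l Λ) {m n : R} (hm : m ∈ peirceCorner F e (star e))
    (hn : n ∈ peirceCorner F (star e) e) {ε : ℤ} (hε : ε = 1 ∨ ε = -1) (hm' : star m = ε • m)
    (hn' : star n = ε • n) :
    ∀ᶠ j in l, ∀ v ∈ halfTrace (Λ j) e, m * n * v ∈ halfTrace (Λ j) e := by
  rcases hε with rfl | rfl
  · exact h.eventually_symm_mul_symm_mul_mem h2 hl hm hn (by simpa using hm') (by simpa using hn')
  · exact h.eventually_skew_mul_skew_mul_mem hl hm hn (by simpa using hm') (by simpa using hn')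

/-- Two corner elements that preserve membership of `v` may be applied in succession after the
product of two elements of `e R e*` and `e* R e` of the same parity. -/
theorem eventually_mul_mul_corner_mul_mem (h : IsFullSkewIdempotent F e) (h2 : (2 : F) ≠ 0)
    (hl : EventuallyContainsBrackets l Λ) {a b m n : R} (ha : a ∈ peirceCorner F e e)
    (hb : b ∈ peirceCorner F e e) (hm : m ∈ peirceCorner F e (star e))
    (hn : n ∈ peirceCorner F (star e) e) {ε : ℤ} (hε : ε = 1 ∨ ε = -1) (hm' : star m = ε • m)
    (hn' : star n = ε • n) :
    ∀ᶠ j in l, ∀ v, v ∈ halfTrace (Λ j) e → a * v ∈ halfTrace (Λ j) e →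
      b * v ∈ halfTrace (Λ j) e → a * b * (m * n) * v ∈ halfTrace (Λ j) e := by
  -- Passing from m to xm + mx* preserves parity, so corner elements can be moved across m at the
  -- cost of a star.
  have twist {x : R} (hx : x ∈ peirceCorner F e e) :
      x * m + m * star x ∈ peirceCorner F e (star e) ∧
        star (x * m + m * star x) = ε • (x * m + m * star x) := by
    refine ⟨add_mem (peirceCorner_mul hx hm) (peirceCorner_mul hm (star_mem_peirceCorner hx)), ?_⟩
    simp only [star_add, star_mul, star_star, hm', smul_add, mul_smul_comm, smul_mul_assoc]
    abel
  have twist' : star b * n + n * b ∈ peirceCorner F (star e) e ∧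
      star (star b * n + n * b) = ε • (star b * n + n * b) := by
    refine ⟨add_mem (peirceCorner_mul (star_mem_peirceCorner hb) hn) (peirceCorner_mul hn hb), ?_⟩
    simp only [star_add, star_mul, star_star, hn', smul_add, mul_smul_comm, smul_mul_assoc]
    abel
  have hba := peirceCorner_mul hb ha
  have hmn := peirceCorner_mul hm hn
  have hmbn : m * star b * n ∈ peirceCorner F e e :=
    peirceCorner_mul (peirceCorner_mul hm (star_mem_peirceCorner hb)) hn
  filter_upwards [
    h.eventually_corner_mul_corner_mul_mem h2 hl (twist ha).1 hn hε (twist ha).2 hn',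
    h.eventually_corner_mul_corner_mul_mem h2 hl (twist hb).1 hn hε (twist hb).2 hn',
    h.eventually_corner_mul_corner_mul_mem h2 hl (twist ha).1 twist'.1 hε (twist ha).2 twist'.2,
    h.eventually_corner_mul_corner_mul_mem h2 hl (twist hba).1 hn hε (twist hba).2 hn',
    h.eventually_commutator_mul_mem hl ha hmbn,
    h.eventually_commutator_mul_mem hl ha (peirceCorner_mul hb hmn),
    h.eventually_commutator_mul_mem hl hb hmn,
    h.eventually_commutator_mul_mem hl hmn hba] with j f1 f2 f3 f4 c1 c2 c3 c4 v hv hav hbv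
  have total : (2 : F) • (a * b * (m * n) * v) ∈ halfTrace (Λ j) e := by
    -- Expanding, `t1` is (mb*na - bamn)v and `t2` is (bmna + bamn)v. The commutators then turn this
    -- into 2abmn v.
    have t1 := sub_mem (sub_mem (sub_mem (f3 v hv) (f1 _ hbv)) (f4 v hv)) (c1 v hv)
    have t2 := sub_mem (f2 _ hav) t1
    have t3 := add_mem (add_mem (add_mem (c2 v hv) (c2 v hv)) t2) (add_mem (c3 _ hav) (c4 v hv))
    convert t3 using 1
    simp only [two_smul, star_mul, mul_add, add_mul, sub_mul, mul_assoc]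
    abel
  have := Submodule.smul_mem _ (2 : F)⁻¹ total
  rwa [smul_smul, inv_mul_cancel₀ h2, one_smul] at this

/-- Adjacent factors commute modulo the elements with skew part in `Λ j`. -/
theorem eventually_swap_mul_mem (h : IsFullSkewIdempotent F e)
    (hl : EventuallyContainsBrackets l Λ) {x b c y : R} (hx : x ∈ peirceCorner F e e)
    (hb : b ∈ peirceCorner F e e) (hc : c ∈ peirceCorner F e e) (hy : y ∈ peirceCorner F e e) :
    ∀ᶠ j in l, ∀ v, v ∈ halfTrace (Λ j) e → c * v ∈ halfTrace (Λ j) e →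
      x * c * b * y * v ∈ halfTrace (Λ j) e → x * b * c * y * v ∈ halfTrace (Λ j) e := by
  have hyx := peirceCorner_mul hy hx
  filter_upwards [
    h.eventually_commutator_mul_mem hl (peirceCorner_mul (peirceCorner_mul hx hb) hc) hy,
    h.eventually_commutator_mul_mem hl hyx hb,
    h.eventually_commutator_mul_mem hl hb (peirceCorner_mul hyx hc),
    h.eventually_commutator_mul_mem hl hy (peirceCorner_mul (peirceCorner_mul hx hc) hb)]
    with j c1 c2 c3 c4 v hv hcv hxv
  -- The commutators telescope along xbcy → yxbc → byxc → yxcb → xcby. Only the second step leaves a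
  -- letter, c, next to v.
  convert add_mem (add_mem (add_mem (add_mem (c1 v hv) (c2 _ hcv)) (c3 v hv)) (c4 v hv)) hxv
    using 1
  simp only [sub_mul, mul_assoc]
  abel

end IsFullSkewIdempotent

end Eventual

/-! ### Words in the corner, module generators, and a decomposition of e. -/

section Generation

open Filter

variable {F : Type*} [Field F] [StarRing F] [TrivialStar F]
  {R : Type*} [NonUnitalRing R] [StarRing R] [Module F R] [IsScalarTower F R R]
  [SMulCommClass F R R] [StarModule F R]

/-- Products of `n` elements of `G`, with `e` as the empty product. -/
def cornerWords {R : Type*} [Mul R] (e : R) (G : Set R) : ℕ → Set R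
  | 0 => {e}
  | n + 1 => Set.image2 (· * ·) G (cornerWords e G n)

theorem cornerWords_finite {e : R} {G : Set R} (hG : G.Finite) (n : ℕ) :
    (cornerWords e G n).Finite := by
  induction n with
  | zero => exact Set.finite_singleton e
  | succ n ih => exact hG.image2 _ ih

theorem cornerWords_subset {e : R} {G : Set R} (he : e * e = e)
    (hG : G ⊆ peirceCorner F e e) (n : ℕ) : cornerWords e G n ⊆ peirceCorner F e e := by
  induction n with
  | zero => rintro _ rfl; exact ⟨he, he⟩
  | succ n ih =>
    rintro _ ⟨g, hg, w, hw, rfl⟩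
    exact peirceCorner_mul (hG hg) (ih hw)

theorem mul_mem_cornerWords {e : R} {G : Set R} (he : e * e = e)
    (hG : G ⊆ peirceCorner F e e) {a b : ℕ} {x y : R} (hx : x ∈ cornerWords e G a)
    (hy : y ∈ cornerWords e G b) : x * y ∈ cornerWords e G (a + b) := by
  induction a generalizing x with
  | zero =>
    obtain rfl : x = e := hx
    rwa [zero_add, (cornerWords_subset he hG b hy).1]
  | succ a ih =>
    obtain ⟨g, hg, w, hw, rfl⟩ := hx
    rw [Nat.add_right_comm]
    exact ⟨g, hg, w * y, ih hw, (mul_assoc _ _ _).symm⟩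

theorem exists_mul_of_mem_cornerWords {e : R} {G : Set R} (he : e * e = e)
    (hG : G ⊆ peirceCorner F e e) {a b : ℕ} {w : R} (hw : w ∈ cornerWords e G (a + b)) :
    ∃ x ∈ cornerWords e G a, ∃ y ∈ cornerWords e G b, w = x * y := by
  induction a generalizing w with
  | zero =>
    rw [zero_add] at hw
    exact ⟨e, rfl, w, hw, (cornerWords_subset he hG b hw).1.symm⟩
  | succ a ih =>
    rw [Nat.add_right_comm] at hw
    obtain ⟨g, hg, w', hw', rfl⟩ := hw
    obtain ⟨x, hx, y, hy, rfl⟩ := ih hw'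
    exact ⟨g * x, ⟨g, hg, x, hx, rfl⟩, y, hy, (mul_assoc _ _ _).symm⟩

/-- The identity e of the corner, as a letter, pads short words; a condition on words of one length
thus covers all shorter words. -/
theorem cornerWords_mono {e : R} {G : Set R} (he : e * e = e)
    (hG : G ⊆ peirceCorner F e e) (heG : e ∈ G) : Monotone (cornerWords e G) :=
  monotone_nat_of_le_succ fun n w hw =>
    ⟨e, heG, w, hw, (cornerWords_subset he hG n hw).1⟩

theorem List.exists_append_of_not_nodup {α : Type*} {s : List α} (hs : ¬ s.Nodup) :
    ∃ i p q t, s = p ++ i :: (q ++ i :: t) := by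
  induction s with
  | nil => simp at hs
  | cons x s ih =>
    rw [List.nodup_cons, not_and_or, not_not] at hs
    rcases hs with hx | hs
    · obtain ⟨q, t, rfl⟩ := List.append_of_mem hx
      exact ⟨x, [], q, t, rfl⟩
    · obtain ⟨i, p, q, t, rfl⟩ := ih hs
      exact ⟨i, x :: p, q, t, rfl⟩

/-- The product of `u i` over a list of indices, with `e` as the empty product. -/
def listWord {R κ : Type*} [Mul R] (e : R) (u : κ → R) (s : List κ) : R :=
  (s.map u).foldr (· * ·) e

theorem listWord_mem {κ : Type*} {e : R} {G : Set R} {u : κ → R} (hu : ∀ i, u i ∈ G)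
    (s : List κ) : listWord e u s ∈ cornerWords e G s.length := by
  induction s with
  | nil => rfl
  | cons i s ih => exact ⟨u i, hu i, _, ih, rfl⟩

theorem listWord_cons {κ : Type*} {e : R} {u : κ → R} (i : κ) (s : List κ) :
    listWord e u (i :: s) = u i * listWord e u s := rfl

theorem listWord_append {κ : Type*} {e : R} {u : κ → R} (he : e * e = e)
    (hu : ∀ i, u i ∈ peirceCorner F e e) (s t : List κ) :
    listWord e u (s ++ t) = listWord e u s * listWord e u t := by
  have hmem (s : List κ) : e * listWord e u s = listWord e u s := by
    cases s with
    | nil => exact he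
    | cons i s => rw [listWord_cons, ← mul_assoc, (hu i).1]
  induction s with
  | nil => exact (hmem t).symm
  | cons i s ih => rw [List.cons_append, listWord_cons, ih, listWord_cons, mul_assoc]

theorem exists_finite_mem_span_mul_mul {e x : R}
    (hx : x ∈ Submodule.span F {x : R | ∃ a b : R, x = a * e * b}) :
    ∃ B : Set R, B.Finite ∧ x ∈ Submodule.span F {x : R | ∃ a ∈ B, ∃ b ∈ B, x = a * e * b} := by
  induction hx using Submodule.span_induction with
  | mem z hz =>
    obtain ⟨a, b, rfl⟩ := hz
    exact ⟨{a, b}, by simp, Submodule.subset_span ⟨a, by simp, b, by simp, rfl⟩⟩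
  | zero => exact ⟨∅, Set.finite_empty, zero_mem _⟩
  | add y z _ _ hy hz =>
    obtain ⟨B, hB, hy⟩ := hy
    obtain ⟨C, hC, hz⟩ := hz
    refine ⟨B ∪ C, hB.union hC, add_mem (Submodule.span_mono ?_ hy) (Submodule.span_mono ?_ hz)⟩
    · rintro _ ⟨a, ha, b, hb, rfl⟩
      exact ⟨a, .inl ha, b, .inl hb, rfl⟩
    · rintro _ ⟨a, ha, b, hb, rfl⟩
      exact ⟨a, .inr ha, b, .inr hb, rfl⟩
  | smul c y _ hy =>
    obtain ⟨B, hB, hy⟩ := hy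
    exact ⟨B, hB, Submodule.smul_mem _ c hy⟩

namespace IsFullSkewIdempotent

variable {e : R}

theorem mul_mul_mem_corner (h : IsFullSkewIdempotent F e) (x : R) :
    e * x * e ∈ peirceCorner F e e :=
  ⟨by rw [← mul_assoc, ← mul_assoc, h.idem], by rw [mul_assoc, h.idem]⟩

/-- `e R (1 - e - e*)` is generated by finitely many elements as a module over a finitely
generated subalgebra of `e R e`. -/
theorem exists_finite_generators (h : IsFullSkewIdempotent F e) (hR : IsFinGenAlgebra F R) :
    ∃ G X : Set R, G.Finite ∧ X.Finite ∧ G ⊆ peirceCorner F e e ∧ X ⊆ peirceHalf F e ∧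
      ∀ T : Submodule F R, X ⊆ T → (∀ g ∈ G, ∀ v ∈ T, g * v ∈ T) → peirceHalf F e ≤ T := by
  obtain ⟨S, hS⟩ := hR
  have hB (x : R) := exists_finite_mem_span_mul_mul (F := F) (e := e) (x := x)
    (by rw [h.full]; trivial)
  choose B₀ hB₀ hspan using hB
  set B : Set R := ⋃ x ∈ S, B₀ x
  have hBfin : B.Finite := S.finite_toSet.biUnion fun x _ => hB₀ x
  have hBspan : ∀ x ∈ S, x ∈ Submodule.span F {x : R | ∃ a ∈ B, ∃ b ∈ B, x = a * e * b} := by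
    intro x hx
    refine Submodule.span_mono ?_ (hspan x)
    rintro _ ⟨a, ha, b, hb, rfl⟩
    exact ⟨a, Set.mem_biUnion hx ha, b, Set.mem_biUnion hx hb, rfl⟩
  set p : R →ₗ[F] R := LinearMap.id - LinearMap.mulRight F e - LinearMap.mulRight F (star e)
  have hp (x : R) : p x = x - x * e - x * star e := rfl
  have hpmul (x y : R) : p (x * y) = x * p y := by simp only [hp, mul_sub, mul_assoc]
  -- Each generator of R is a combination of products a e b with a, b in B. The middle e cuts a
  -- product of generators into corner factors eae, e(ba)e and a last factor eb.
  refine ⟨(fun a => e * a * e) '' B ∪ Set.image2 (fun b a => e * (b * a) * e) B B,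
    (fun b => p (e * b)) '' B, (hBfin.image _).union (hBfin.image2 _ hBfin), hBfin.image _,
    ?_, ?_, ?_⟩
  · rintro _ (⟨a, -, rfl⟩ | ⟨b, -, a, -, rfl⟩) <;> exact h.mul_mul_mem_corner _
  · rintro _ ⟨b, -, rfl⟩
    exact h.mem_half_of_mul b
  intro T hX hG
  -- A general left-linear q covers both `p` and right multiplication by z followed by `p`. The
  -- second is needed for products of generators.
  have step (q : R →ₗ[F] R) (hq : ∀ x y, q (x * y) = x * q y) (hqB : ∀ b ∈ B, q (e * b) ∈ T)
      (x : R) (hx : x ∈ S) : q (e * x) ∈ T ∧ ∀ b ∈ B, q (e * (b * x)) ∈ T := by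
    have := hBspan x hx
    clear hx
    induction this using Submodule.span_induction with
    | mem z hz =>
      obtain ⟨a, ha, b, hb, rfl⟩ := hz
      refine ⟨?_, fun b' hb' => ?_⟩
      · have e1 : e * (a * e * b) = e * a * e * (e * b) := by
          simp only [mul_assoc]
          rw [← mul_assoc e e b, h.idem]
        rw [e1, hq]
        exact hG _ (.inl ⟨a, ha, rfl⟩) _ (hqB b hb)
      · have e1 : e * (b' * (a * e * b)) = e * (b' * a) * e * (e * b) := by
          simp only [mul_assoc]
          rw [← mul_assoc e e b, h.idem]
        rw [e1, hq]
        exact hG _ (.inr ⟨b', hb', a, ha, rfl⟩) _ (hqB b hb)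
    | zero => simp
    | add y z _ _ hy hz =>
      refine ⟨?_, fun b hb => ?_⟩
      · rw [mul_add, map_add]; exact add_mem hy.1 hz.1
      · rw [mul_add, mul_add, map_add]; exact add_mem (hy.2 b hb) (hz.2 b hb)
    | smul c y _ hy =>
      refine ⟨?_, fun b hb => ?_⟩
      · rw [mul_smul_comm, map_smul]; exact Submodule.smul_mem _ c hy.1
      · rw [mul_smul_comm, mul_smul_comm, map_smul]; exact Submodule.smul_mem _ c (hy.2 b hb)
  let Q : Submodule F R :=
    { carrier := {x | p (e * x) ∈ T ∧ ∀ b ∈ B, p (e * (b * x)) ∈ T}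
      zero_mem' := by simp
      add_mem' := by
        rintro y z hy hz
        refine ⟨?_, fun b hb => ?_⟩
        · rw [mul_add, map_add]; exact add_mem hy.1 hz.1
        · rw [mul_add, mul_add, map_add]; exact add_mem (hy.2 b hb) (hz.2 b hb)
      smul_mem' := by
        rintro c y hy
        refine ⟨?_, fun b hb => ?_⟩
        · rw [mul_smul_comm, map_smul]; exact Submodule.smul_mem _ c hy.1
        · rw [mul_smul_comm, mul_smul_comm, map_smul]; exact Submodule.smul_mem _ c (hy.2 b hb) }
  have hQ : ∀ x : R, x ∈ Q ∧ ∀ z ∈ Q, x * z ∈ Q := by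
    intro x
    have hx : x ∈ NonUnitalAlgebra.adjoin F (S : Set R) := by rw [hS]; trivial
    induction hx using NonUnitalAlgebra.adjoin_induction with
    | mem x hx =>
      refine ⟨step p hpmul (fun b hb => hX ⟨b, hb, rfl⟩) x hx, fun z hz => ?_⟩
      have := step (p ∘ₗ LinearMap.mulRight F z)
        (fun x y => by simp only [LinearMap.comp_apply, LinearMap.mulRight_apply, mul_assoc, hpmul])
        (fun b hb => by
          simpa only [LinearMap.comp_apply, LinearMap.mulRight_apply, mul_assoc] using hz.2 b hb)
        x hx
      simp only [LinearMap.comp_apply, LinearMap.mulRight_apply, mul_assoc] at this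
      exact this
    | add x y _ _ hx hy =>
      exact ⟨add_mem hx.1 hy.1, fun z hz => by
        rw [add_mul]; exact add_mem (hx.2 z hz) (hy.2 z hz)⟩
    | zero => exact ⟨zero_mem _, fun z _ => by rw [zero_mul]; exact zero_mem _⟩
    | mul x y _ _ hx hy =>
      exact ⟨hx.2 y hy.1, fun z hz => by rw [mul_assoc]; exact hx.2 _ (hy.2 z hz)⟩
    | smul c x _ hx =>
      exact ⟨Submodule.smul_mem _ c hx.1, fun z hz => by
        rw [smul_mul_assoc]; exact Submodule.smul_mem _ c (hx.2 z hz)⟩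
  intro v hv
  have := (hQ v).1.1
  rwa [hv.1, hp, hv.2.1, hv.2.2, sub_zero, sub_zero] at this

/-- `e` is a sum of products of symmetric or skew elements of `e R e*` and `e* R e`. -/
theorem exists_sum_homogeneous (h : IsFullSkewIdempotent F e) (h2 : (2 : F) ≠ 0) :
    ∃ (r : ℕ) (m n : Fin r → R) (ε δ : Fin r → ℤ), (∀ i, m i ∈ peirceCorner F e (star e)) ∧
      (∀ i, n i ∈ peirceCorner F (star e) e) ∧ (∀ i, ε i = 1 ∨ ε i = -1) ∧
      (∀ i, δ i = 1 ∨ δ i = -1) ∧ (∀ i, star (m i) = ε i • m i) ∧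
      (∀ i, star (n i) = δ i • n i) ∧ ∑ i, m i * n i = e := by
  set H : Set R := {x | ∃ m ∈ peirceCorner F e (star e), ∃ n ∈ peirceCorner F (star e) e,
    ∃ ε δ : ℤ, (ε = 1 ∨ ε = -1) ∧ (δ = 1 ∨ δ = -1) ∧ star m = ε • m ∧ star n = δ • n ∧
      x = m * n}
  have half {p : R} {x : R} (hx : x ∈ peirceCorner F (star p) p) :
      (2 : F)⁻¹ • (x + star x) + (2 : F)⁻¹ • (x - star x) = x := by
    rw [← smul_add, add_add_sub_cancel, ← two_smul F, smul_smul, inv_mul_cancel₀ h2, one_smul]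
  have hsplit {p : R} {x : R} (hx : x ∈ peirceCorner F (star p) p) :
      ((2 : F)⁻¹ • (x + star x) ∈ peirceCorner F (star p) p ∧
        star ((2 : F)⁻¹ • (x + star x)) = (1 : ℤ) • (2 : F)⁻¹ • (x + star x)) ∧
      ((2 : F)⁻¹ • (x - star x) ∈ peirceCorner F (star p) p ∧
        star ((2 : F)⁻¹ • (x - star x)) = (-1 : ℤ) • (2 : F)⁻¹ • (x - star x)) := by
    have sx := star_mem_peirceCorner hx
    rw [star_star] at sx
    refine ⟨⟨Submodule.smul_mem _ _ (add_mem hx sx), ?_⟩,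
      ⟨Submodule.smul_mem _ _ (sub_mem hx sx), ?_⟩⟩
    · rw [star_smul, star_trivial (2 : F)⁻¹, star_add, star_star, one_smul, add_comm]
    · rw [star_smul, star_trivial (2 : F)⁻¹, star_sub, star_star, neg_smul, one_smul, ← smul_neg,
        neg_sub]
  have hprod {m n : R} (hm : m ∈ peirceCorner F e (star e))
      (hn : n ∈ peirceCorner F (star e) e) : m * n ∈ Submodule.span F H := by
    have hm' : m ∈ peirceCorner F (star (star e)) (star e) := by rwa [star_star]
    obtain ⟨⟨a1, a2⟩, ⟨b1, b2⟩⟩ := hsplit hm'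
    obtain ⟨⟨c1, c2⟩, ⟨d1, d2⟩⟩ := hsplit hn
    rw [star_star] at a1 b1
    rw [← half hm', ← half hn, add_mul, mul_add, mul_add]
    refine add_mem (add_mem ?_ ?_) (add_mem ?_ ?_) <;> apply Submodule.subset_span
    · exact ⟨_, a1, _, c1, _, _, .inl rfl, .inl rfl, a2, c2, rfl⟩
    · exact ⟨_, a1, _, d1, _, _, .inl rfl, .inr rfl, a2, d2, rfl⟩
    · exact ⟨_, b1, _, c1, _, _, .inr rfl, .inl rfl, b2, c2, rfl⟩
    · exact ⟨_, b1, _, d1, _, _, .inr rfl, .inr rfl, b2, d2, rfl⟩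
  have hspan (x : R) : e * x * e ∈ Submodule.span F H := by
    -- Fullness of e* gives eRe = (eRe*)(e*Re), after which each factor splits into symmetric and
    -- skew halves.
    induction x using h.conj.induction_full F with
    | mem a b =>
      have e1 : e * (a * star e * b) * e = (e * a * star e) * (star e * b * e) := by
        simp only [mul_assoc]
        rw [← mul_assoc (star e) (star e), h.star_idem]
      rw [e1]
      refine hprod ⟨?_, ?_⟩ ⟨?_, ?_⟩
      · rw [← mul_assoc, ← mul_assoc, h.idem]
      · rw [mul_assoc, h.star_idem]
      · rw [← mul_assoc, ← mul_assoc, h.star_idem]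
      · rw [mul_assoc, h.idem]
    | zero => simp
    | add x y hx hy => rw [mul_add, add_mul]; exact add_mem hx hy
    | smul c x hx => rw [mul_smul_comm, smul_mul_assoc]; exact Submodule.smul_mem _ c hx
  have he := hspan e
  rw [h.idem, h.idem, Submodule.mem_span_set'] at he
  obtain ⟨r, c, g, hg⟩ := he
  choose m hm n hn ε δ hε hδ hm' hn' hmn using fun i => (g i).2
  refine ⟨r, fun i => c i • m i, n, ε, δ, fun i => Submodule.smul_mem _ _ (hm i), hn, hε, hδ,
    fun i => ?_, hn', ?_⟩
  · rw [star_smul, star_trivial (c i), hm', smul_comm]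
  · rw [← hg]
    exact Finset.sum_congr rfl fun i _ => by rw [smul_mul_assoc, hmn]

end IsFullSkewIdempotent

end Generation

/-! ### Reduction of long words by a repeated letter. -/

section Main

open Filter

variable {F : Type*} [Field F] [StarRing F] [TrivialStar F]
  {R : Type*} [NonUnitalRing R] [StarRing R] [Module F R] [IsScalarTower F R R]
  [SMulCommClass F R R] [StarModule F R]

namespace IsFullSkewIdempotent

variable {e : R} {ι : Type*} {l : Filter ι} {Λ : ι → LieSubalgebra F R}

/-- Regrouping the square as (mnm)n makes the parities agree: m occurs twice in mnm, so its sign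
cancels and the sign of n remains. -/
theorem eventually_mul_mul_sq_mem (h : IsFullSkewIdempotent F e) (h2 : (2 : F) ≠ 0)
    (hl : EventuallyContainsBrackets l Λ) {a b m n : R} (ha : a ∈ peirceCorner F e e)
    (hb : b ∈ peirceCorner F e e) (hm : m ∈ peirceCorner F e (star e))
    (hn : n ∈ peirceCorner F (star e) e) {ε δ : ℤ} (hε : ε = 1 ∨ ε = -1) (hδ : δ = 1 ∨ δ = -1)
    (hm' : star m = ε • m) (hn' : star n = δ • n) :
    ∀ᶠ j in l, ∀ v, v ∈ halfTrace (Λ j) e → a * v ∈ halfTrace (Λ j) e →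
      b * v ∈ halfTrace (Λ j) e → a * b * (m * n * (m * n)) * v ∈ halfTrace (Λ j) e := by
  have hm'' : star (m * n * m) = δ • (m * n * m) := by
    rw [star_mul, star_mul, hm', hn']
    rcases hε with rfl | rfl <;> simp [mul_assoc, smul_mul_assoc, mul_smul_comm]
  filter_upwards [h.eventually_mul_mul_corner_mul_mem h2 hl ha hb
    (peirceCorner_mul (peirceCorner_mul hm hn) hm) hn hδ hm'' hn'] with j hj v hv hav hbv
  simpa only [mul_assoc] using hj v hv hav hbv

/-- If all words of length `2 * r + 3` keep `v` in `halfTrace (Λ j) e`, then so do the words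
`a * b * w` with `a`, `b` of length `r + 2` and a factor `w` in which some `u i` is repeated. -/
theorem eventually_mul_mul_listWord_mem (h : IsFullSkewIdempotent F e) (h2 : (2 : F) ≠ 0)
    (hl : EventuallyContainsBrackets l Λ) {r : ℕ} {m n : Fin r → R} {ε δ : Fin r → ℤ}
    (hm : ∀ i, m i ∈ peirceCorner F e (star e)) (hn : ∀ i, n i ∈ peirceCorner F (star e) e)
    (hε : ∀ i, ε i = 1 ∨ ε i = -1) (hδ : ∀ i, δ i = 1 ∨ δ i = -1)
    (hm' : ∀ i, star (m i) = ε i • m i) (hn' : ∀ i, star (n i) = δ i • n i)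
    {G : Set R} (hG : G ⊆ peirceCorner F e e) (heG : e ∈ G) (huG : ∀ i, m i * n i ∈ G)
    {s : List (Fin r)} (hs : s.length = r + 1) {a b : R} (ha : a ∈ cornerWords e G (r + 2))
    (hb : b ∈ cornerWords e G (r + 2)) :
    ∀ᶠ j in l, ∀ v, (∀ w ∈ cornerWords e G (2 * r + 3), w * v ∈ halfTrace (Λ j) e) →
      a * b * listWord e (fun i => m i * n i) s * v ∈ halfTrace (Λ j) e := by
  set u : Fin r → R := fun i => m i * n i
  have hu (i) : u i ∈ peirceCorner F e e := hG (huG i)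
  have hnd : ¬ s.Nodup := fun hnd => by
    have := hnd.length_le_card
    rw [Fintype.card_fin] at this
    omega
  obtain ⟨i, p, q, t, rfl⟩ := List.exists_append_of_not_nodup hnd
  simp only [List.length_append, List.length_cons] at hs
  have hsub := cornerWords_subset (F := F) h.idem hG
  have hmono := cornerWords_mono (F := F) h.idem hG heG
  have hp := listWord_mem (e := e) (u := u) huG p
  have hq := listWord_mem (e := e) (u := u) huG q
  have ht := listWord_mem (e := e) (u := u) huG t
  have hta := mul_mem_cornerWords h.idem hG ht ha
  have hbpq := mul_mem_cornerWords h.idem hG (mul_mem_cornerWords h.idem hG hb hp) hq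
  have hword : listWord e u (p ++ i :: (q ++ i :: t)) =
      listWord e u p * (u i * (listWord e u q * (u i * listWord e u t))) := by
    rw [listWord_append h.idem hu, listWord_cons, listWord_append h.idem hu, listWord_cons]
  rw [hword]
  generalize listWord e u p = P at *
  generalize listWord e u q = Q at *
  generalize listWord e u t = S at *
  have hA := hsub _ ha
  have hB := hsub _ hb
  have hP := hsub _ hp
  have hQ := hsub _ hq
  have hS := hsub _ ht
  have hX : a * b * P ∈ peirceCorner F e e := peirceCorner_mul (peirceCorner_mul hA hB) hP
  -- With u the repeated letter, start from (Sa)(bPQ)uu, rotate S to the right end by a commutator,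
  -- then swap Q with the first u to reach abPuQuS.
  filter_upwards [h.eventually_mul_mul_sq_mem h2 hl (hsub _ hta) (hsub _ hbpq) (hm i) (hn i)
      (hε i) (hδ i) (hm' i) (hn' i),
    h.eventually_swap_mul_mem hl hX (hu i) hQ (peirceCorner_mul (hu i) hS),
    h.eventually_commutator_mul_mem hl
      (peirceCorner_mul (peirceCorner_mul hX hQ) (peirceCorner_mul (hu i) (hu i))) hS]
    with j f1 f2 f3 v hv
  have hle {k : ℕ} (hk : k ≤ 2 * r + 3) {w : R} (hw : w ∈ cornerWords e G k) :
      w * v ∈ halfTrace (Λ j) e := hv w (hmono hk hw)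
  have hev : e * v ∈ halfTrace (Λ j) e := hle (Nat.zero_le _) rfl
  have absorb {x : R} (hx : x ∈ peirceCorner F e e) : x * (e * v) = x * v := by
    rw [← mul_assoc, hx.2]
  have h3 := f1 (e * v) hev
    (by rw [absorb (hsub _ hta)]; exact hle (by omega) hta)
    (by rw [absorb (hsub _ hbpq)]; exact hle (by omega) hbpq)
  have h4 := f2 (e * v) hev (by rw [absorb hQ]; exact hle (by omega) hq) (by
    convert add_mem h3 (f3 (e * v) hev) using 1
    simp only [sub_mul, mul_assoc, u]
    abel)
  have hall : a * b * (P * (u i * (Q * (u i * S)))) ∈ peirceCorner F e e :=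
    peirceCorner_mul (peirceCorner_mul hA hB) (peirceCorner_mul hP (peirceCorner_mul (hu i)
      (peirceCorner_mul hQ (peirceCorner_mul (hu i) hS))))
  rw [← absorb hall]
  simpa only [mul_assoc] using h4

/-- Eventually `Λ j` contains all skew parts of elements of `e R (1 - e - e*)`. -/
theorem eventually_half_le (h : IsFullSkewIdempotent F e) (h2 : (2 : F) ≠ 0)
    (hR : IsFinGenAlgebra F R) (hl : EventuallyContainsBrackets l Λ) :
    ∀ᶠ j in l, peirceHalf F e ≤ halfTrace (Λ j) e := by
  obtain ⟨G₀, X, hG₀fin, hXfin, hG₀, hX, hgen⟩ := h.exists_finite_generators hR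
  obtain ⟨r, m, n, ε, δ, hm, hn, hε, hδ, hm', hn', hsum⟩ := h.exists_sum_homogeneous h2
  set u : Fin r → R := fun i => m i * n i
  have hu (i) : u i ∈ peirceCorner F e e := peirceCorner_mul (hm i) (hn i)
  set G : Set R := insert e (G₀ ∪ Set.range u)
  have hGfin : G.Finite := (hG₀fin.union (Set.finite_range u)).insert e
  have hG : G ⊆ peirceCorner F e e := by
    rintro g (rfl | hg | ⟨i, rfl⟩)
    · exact h.mem_corner
    · exact hG₀ hg
    · exact hu i
  have heG : e ∈ G := Set.mem_insert _ _
  have huG (i) : u i ∈ G := .inr (.inr ⟨i, rfl⟩)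
  have hsub := cornerWords_subset (F := F) h.idem hG
  have hmono := cornerWords_mono (F := F) h.idem hG heG
  have hlong : ∀ᶠ j in l, ∀ s ∈ {s : List (Fin r) | s.length = r + 1},
      ∀ a ∈ cornerWords e G (r + 2), ∀ b ∈ cornerWords e G (r + 2),
      ∀ v, (∀ w ∈ cornerWords e G (2 * r + 3), w * v ∈ halfTrace (Λ j) e) →
        a * b * listWord e u s * v ∈ halfTrace (Λ j) e := by
    rw [eventually_all_finite (List.finite_length_eq _ _)]
    intro s hs
    rw [eventually_all_finite (cornerWords_finite hGfin _)]
    intro a ha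
    rw [eventually_all_finite (cornerWords_finite hGfin _)]
    intro b hb
    exact h.eventually_mul_mul_listWord_mem h2 hl hm hn hε hδ hm' hn' hG heG huG hs ha hb
  have hbase : ∀ᶠ j in l, ∀ x ∈ X, ∀ w ∈ cornerWords e G (2 * r + 3),
      w * x ∈ halfTrace (Λ j) e := by
    rw [eventually_all_finite hXfin]
    intro x hx
    rw [eventually_all_finite (cornerWords_finite hGfin _)]
    intro w hw
    exact h.eventually_mem_halfTrace hl (corner_mul_half (hsub _ hw) (hX hx))
  filter_upwards [hlong, hbase] with j hj hj'
  -- The bound 2r + 3 is chosen so that one more letter gives length 2(r + 2), which splits into two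
  -- words of length r + 2. Their extensions by the pieces of a word with r + 1 letters still fit
  -- within the bound.
  let T : Submodule F R :=
    { carrier := {v | v ∈ peirceHalf F e ∧
        ∀ w ∈ cornerWords e G (2 * r + 3), w * v ∈ halfTrace (Λ j) e}
      zero_mem' := by simp
      add_mem' := by
        rintro x y hx hy
        exact ⟨add_mem hx.1 hy.1, fun w hw => by
          rw [mul_add]; exact add_mem (hx.2 w hw) (hy.2 w hw)⟩
      smul_mem' := by
        rintro c x hx
        exact ⟨Submodule.smul_mem _ c hx.1, fun w hw => by
          rw [mul_smul_comm]; exact Submodule.smul_mem _ c (hx.2 w hw)⟩ }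
  have hT : peirceHalf F e ≤ T := by
    refine hgen T (fun x hx => ⟨hX hx, hj' x hx⟩) fun g hg v hv => ?_
    have hgG : g ∈ G := .inr (.inl hg)
    refine ⟨corner_mul_half (hG hgG) hv.1, fun w hw => ?_⟩
    have hg1 : g ∈ cornerWords e G 1 := ⟨g, hgG, e, rfl, (hG hgG).2⟩
    have hwg := mul_mem_cornerWords h.idem hG hw hg1
    have hlen : 2 * r + 3 + 1 = (r + 2) + (r + 2) := by omega
    rw [hlen] at hwg
    obtain ⟨a, ha, b, hb, hab⟩ := exists_mul_of_mem_cornerWords h.idem hG hwg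
    rw [← mul_assoc, hab]
    -- expand `v = (∑ i, u i) ^ k * v`
    have descend : ∀ k ≤ r + 1, ∀ s : List (Fin r), s.length = r + 1 - k →
        a * b * listWord e u s * v ∈ halfTrace (Λ j) e := by
      intro k
      induction k with
      | zero => exact fun _ s hs => hj s (by simpa using hs) a ha b hb v hv.2
      | succ k ih =>
        intro hk s hs
        have hsmem := hsub _ (listWord_mem (e := e) (u := u) huG s)
        have key : a * b * listWord e u s * v =
            ∑ i, a * b * listWord e u (s ++ [i]) * v := by
          have hword (i : Fin r) : listWord e u (s ++ [i]) = listWord e u s * u i := by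
            rw [listWord_append h.idem hu, listWord_cons]
            congr 1
            exact (hu i).2
          simp only [hword]
          rw [← Finset.sum_mul, ← Finset.mul_sum, ← Finset.mul_sum, hsum, hsmem.2]
        rw [key]
        refine sum_mem fun i _ => ih (by omega) _ ?_
        rw [List.length_append, hs, List.length_singleton]
        omega
    have := descend (r + 1) le_rfl [] (by simp)
    have hnil : listWord e u [] = e := rfl
    rwa [hnil, mul_assoc, hv.1.1] at this
  intro v hv
  have := (hT hv).2 e (hmono (Nat.zero_le _) rfl)
  rwa [hv.1] at this

end IsFullSkewIdempotent

end Main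

/-! ### From the half components to all of [K,K]. -/

section Derived

variable {F : Type*} [Field F] [StarRing F] [TrivialStar F]
  {R : Type*} [NonUnitalRing R] [StarRing R] [Module F R] [IsScalarTower F R R]
  [SMulCommClass F R R] [StarModule F R]

/-- The Peirce component `(1 - e - e*) R (1 - e - e*)`. -/
def peirceZero (F : Type*) {R : Type*} [Field F] [NonUnitalRing R] [StarRing R] [Module F R]
    [IsScalarTower F R R] [SMulCommClass F R R] (e : R) : Submodule F R where
  carrier := {z | (e * z = 0 ∧ star e * z = 0) ∧ z * e = 0 ∧ z * star e = 0}
  zero_mem' := by simp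
  add_mem' := by
    rintro a b ⟨⟨h1, h2⟩, h3, h4⟩ ⟨⟨h5, h6⟩, h7, h8⟩
    exact ⟨⟨by rw [mul_add, h1, h5, add_zero], by rw [mul_add, h2, h6, add_zero]⟩,
      by rw [add_mul, h3, h7, add_zero], by rw [add_mul, h4, h8, add_zero]⟩
  smul_mem' := by
    rintro c a ⟨⟨h1, h2⟩, h3, h4⟩
    exact ⟨⟨by rw [mul_smul_comm, h1, smul_zero], by rw [mul_smul_comm, h2, smul_zero]⟩,
      by rw [smul_mul_assoc, h3, smul_zero], by rw [smul_mul_assoc, h4, smul_zero]⟩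

theorem star_mem_peirceZero {e z : R} (hz : z ∈ peirceZero F e) : star z ∈ peirceZero F e := by
  obtain ⟨⟨h1, h2⟩, h3, h4⟩ := hz
  refine ⟨⟨?_, ?_⟩, ?_, ?_⟩
  · simpa using congrArg star h4
  · simpa using congrArg star h3
  · simpa using congrArg star h2
  · simpa using congrArg star h1

theorem peirceZero_le_star {e z : R} (hz : z ∈ peirceZero F e) : z ∈ peirceZero F (star e) := by
  obtain ⟨⟨h1, h2⟩, h3, h4⟩ := hz
  exact ⟨⟨h2, by rwa [star_star]⟩, h4, by rwa [star_star]⟩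

theorem lie_mem_of_forall_lie_mem {L : Type*} [LieRing L] [LieAlgebra F L] {s : Set L} {k : L}
    (hk : ∀ g ∈ s, ⁅k, g⁆ ∈ LieSubalgebra.lieSpan F L s) {x : L}
    (hx : x ∈ LieSubalgebra.lieSpan F L s) : ⁅k, x⁆ ∈ LieSubalgebra.lieSpan F L s := by
  induction hx using LieSubalgebra.lieSpan_induction with
  | mem x hx => exact hk x hx
  | zero => rw [lie_zero]; exact zero_mem _
  | add x y _ _ hx hy => rw [lie_add]; exact add_mem hx hy
  | smul c x _ hx => rw [lie_smul]; exact (LieSubalgebra.lieSpan F L s).smul_mem c hx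
  | lie x y hx' hy' hx hy =>
    rw [leibniz_lie]
    exact add_mem (LieSubalgebra.lie_mem _ hx hy') (LieSubalgebra.lie_mem _ hx' hy)

namespace IsFullSkewIdempotent

variable {e : R} {Λ : LieSubalgebra F R}

theorem skewMap_mul_mul_star_mem (h : IsFullSkewIdempotent F e)
    (hV : peirceHalf F e ≤ halfTrace Λ e) (x : R) : skewMap F R (e * x * star e) ∈ Λ := by
  induction x using h.induction_cofull F with
  | mem a b =>
    have ha := h.mem_half_of_mul a
    have hb := h.mem_half_of_mul (star b)
    have := Λ.lie_mem (hV ha).2 (hV hb).2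
    rw [h.lie_half_half ha hb, ← h.mul_cofull_mul_star] at this
    exact neg_mem_iff.1 this
  | zero => simp
  | add x y hx hy => rw [mul_add, add_mul, map_add]; exact add_mem hx hy
  | smul c x hx => rw [mul_smul_comm, smul_mul_assoc, map_smul]; exact Λ.smul_mem c hx

theorem lie_half_half_star (h : IsFullSkewIdempotent F e) {v y : R} (hv : v ∈ peirceHalf F e)
    (hy : y ∈ peirceHalf F (star e)) :
    ⁅skewMap F R v, skewMap F R y⁆ = skewMap F R (star y * v) - skewMap F R (v * star y) ∧
      v * star y ∈ peirceCorner F e e ∧ star y * v ∈ peirceZero F e := by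
  refine ⟨lie_skewMap_of_mul_eq_zero (mul_half_half_star hv hy).1 (mul_half_half_star hv hy).2,
    h.half_mul_star_half_star hv hy, ⟨?_, ?_⟩, ?_, ?_⟩
  · have := (h.conj.half_star_eq hy).2.2.1
    rw [star_star] at this
    rw [← mul_assoc, this, zero_mul]
  · rw [← mul_assoc, (h.conj.half_star_eq hy).2.1, zero_mul]
  · rw [mul_assoc, hv.2.1, mul_zero]
  · rw [mul_assoc, hv.2.2, mul_zero]

/-- A subspace containing `Λ` contains all skew parts as soon as it contains those of the
diagonal Peirce components. -/
theorem skewMap_mem_of_diagonal (h : IsFullSkewIdempotent F e)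
    (hV : peirceHalf F e ≤ halfTrace Λ e) (hW : peirceHalf F (star e) ≤ halfTrace Λ (star e))
    {Q : Submodule F R} (hΛ : Λ.toSubmodule ≤ Q)
    (hA : ∀ a ∈ peirceCorner F e e, skewMap F R a ∈ Q)
    (hZ : ∀ z ∈ peirceZero F e, skewMap F R z ∈ Q) (x : R) : skewMap F R x ∈ Q := by
  have h1 := h.idem
  have h2 := h.star_idem
  have h3 := h.mul_star_self
  have h4 := h.star_mul_self
  have m1 := hA _ (h.mul_mul_mem_corner x)
  have m2 := hA _ (h.mul_mul_mem_corner (star x))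
  have m3 := hΛ (h.skewMap_mul_mul_star_mem hV x)
  have m4 := hΛ (h.conj.skewMap_mul_mul_star_mem hW x)
  have m5 := hΛ (hV (h.mem_half_of_mul x)).2
  have m6 := hΛ (hW (h.conj.mem_half_of_mul x)).2
  have m7 := hΛ (hV (h.mem_half_of_mul (star x))).2
  have m8 := hΛ (hW (h.conj.mem_half_of_mul (star x))).2
  have hz : x - e * x - star e * x - x * e - x * star e + e * x * e + e * x * star e +
      star e * x * e + star e * x * star e ∈ peirceZero F e := by
    have i1 : ∀ z, e * (e * z) = e * z := fun z => by rw [← mul_assoc, h1]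
    have i2 : ∀ z, star e * (star e * z) = star e * z := fun z => by rw [← mul_assoc, h2]
    have i3 : ∀ z, e * (star e * z) = 0 := fun z => by rw [← mul_assoc, h3, zero_mul]
    have i4 : ∀ z, star e * (e * z) = 0 := fun z => by rw [← mul_assoc, h4, zero_mul]
    refine ⟨⟨?_, ?_⟩, ?_, ?_⟩ <;>
    · simp only [mul_add, add_mul, mul_sub, sub_mul, mul_assoc, i1, i2, i3, i4, h1, h2, h3, h4,
        mul_zero]
      abel
  have m9 := hZ _ hz
  -- The blocks of x in e*Re*, (1 - e - e*)Re* and (1 - e - e*)Re enter through star x with a minus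
  -- sign, as a and -a* have the same skew part.
  have key := add_mem (add_mem (sub_mem (sub_mem (add_mem (add_mem (add_mem (sub_mem
    m1 m2) m3) m4) m5) m7) m8) m6) m9
  convert key using 1
  simp only [skewMap_apply, star_add, star_sub, star_mul, star_star, mul_assoc]
  abel

/-- By ReR = R, the zero component is spanned by products y*v of half components, and the bracket of
v and y exchanges y*v for the corner element vy*. -/
theorem skewMap_mem_of_corner (h : IsFullSkewIdempotent F e)
    (hV : peirceHalf F e ≤ halfTrace Λ e) (hW : peirceHalf F (star e) ≤ halfTrace Λ (star e))
    {Q : Submodule F R} (hΛ : Λ.toSubmodule ≤ Q)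
    (hA : ∀ a ∈ peirceCorner F e e, skewMap F R a ∈ Q) (x : R) : skewMap F R x ∈ Q := by
  refine h.skewMap_mem_of_diagonal hV hW hΛ hA (fun z hz => ?_) x
  have key (x : R) : skewMap F R (x - e * x - star e * x - x * e - x * star e + e * x * e +
      e * x * star e + star e * x * e + star e * x * star e) ∈ Q := by
    induction x using h.induction_full F with
    | mem a b =>
      have hv := h.mem_half_of_mul b
      have hy := h.conj.mem_half_of_mul (star a)
      obtain ⟨l1, l2, -⟩ := h.lie_half_half_star hv hy
      have := add_mem (hΛ (Λ.lie_mem (hV hv).2 (hW hy).2)) (hA _ l2)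
      rw [l1, sub_add_cancel] at this
      convert this using 2
      have i1 : ∀ z, e * (e * z) = e * z := fun z => by rw [← mul_assoc, h.idem]
      simp only [star_sub, star_mul, star_star, mul_sub, sub_mul, mul_assoc, i1]
      abel
    | zero => simp
    | add x y hx hy =>
      convert add_mem hx hy using 1
      rw [← map_add]
      congr 1
      simp only [mul_add, add_mul]
      abel
    | smul c x hx =>
      convert Q.smul_mem c hx using 1
      rw [← map_smul]
      simp only [smul_add, smul_sub, mul_smul_comm, smul_mul_assoc]
  obtain ⟨⟨h1, h2⟩, h3, h4⟩ := hz
  simpa only [h1, h2, h3, h4, zero_mul, sub_zero, add_zero] using key z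

/-- The opposite exchange: R(1 - e - e*)R = R makes products vy* span the corner. -/
theorem skewMap_mem_of_zero (h : IsFullSkewIdempotent F e)
    (hV : peirceHalf F e ≤ halfTrace Λ e) (hW : peirceHalf F (star e) ≤ halfTrace Λ (star e))
    {Q : Submodule F R} (hΛ : Λ.toSubmodule ≤ Q)
    (hZ : ∀ z ∈ peirceZero F e, skewMap F R z ∈ Q) (x : R) : skewMap F R x ∈ Q := by
  refine h.skewMap_mem_of_diagonal hV hW hΛ (fun a ha => ?_) hZ x
  have key (x : R) : skewMap F R (e * x * e) ∈ Q := by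
    induction x using h.induction_cofull F with
    | mem a b =>
      have hv := h.mem_half_of_mul a
      have hy := h.conj.mem_half_of_mul (star b)
      obtain ⟨l1, -, l2⟩ := h.lie_half_half_star hv hy
      have := sub_mem (hZ _ l2) (hΛ (Λ.lie_mem (hV hv).2 (hW hy).2))
      rw [l1, sub_sub_cancel] at this
      convert this using 2
      have i1 : ∀ z, e * (e * z) = e * z := fun z => by rw [← mul_assoc, h.idem]
      have i2 : ∀ z, star e * (star e * z) = star e * z := fun z => by
        rw [← mul_assoc, h.star_idem]
      have i3 : ∀ z, e * (star e * z) = 0 := fun z => by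
        rw [← mul_assoc, h.mul_star_self, zero_mul]
      have i4 : ∀ z, star e * (e * z) = 0 := fun z => by
        rw [← mul_assoc, h.star_mul_self, zero_mul]
      simp only [star_sub, star_mul, star_star, mul_sub, sub_mul, mul_assoc, i1, i2, i3, i4,
        mul_zero]
      abel
    | zero => simp
    | add x y hx hy => rw [mul_add, add_mul, map_add]; exact add_mem hx hy
    | smul c x hx => rw [mul_smul_comm, smul_mul_assoc, map_smul]; exact Q.smul_mem c hx
  have := key a
  rwa [ha.1, ha.2] at this

theorem lie_zero_half (h : IsFullSkewIdempotent F e) {z v : R} (hz : z ∈ peirceZero F e)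
    (hv : v ∈ peirceHalf F e) :
    ⁅skewMap F R z, skewMap F R v⁆ = skewMap F R (v * star z) - skewMap F R (v * z) := by
  have hz' := star_mem_peirceZero hz
  have hv' := (h.half_star_eq hv).1
  have z1 : z * v = 0 := mul_eq_zero_of_absorb' hz.2.1 hv.1
  have z2 : star z * v = 0 := mul_eq_zero_of_absorb' hz'.2.1 hv.1
  have z3 : star v * z = 0 := mul_eq_zero_of_absorb hv' hz.1.2
  have z4 : star v * star z = 0 := mul_eq_zero_of_absorb hv' hz'.1.2
  simp only [commutatorLieRing_lie, skewMap_apply, mul_sub, sub_mul, z1, z2, z3, z4, star_mul,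
    star_star]
  abel

theorem half_mul_zero {z v : R} (hv : v ∈ peirceHalf F e) (hz : z ∈ peirceZero F e) :
    v * z ∈ peirceHalf F e :=
  ⟨by rw [← mul_assoc, hv.1], by rw [mul_assoc, hz.2.1, mul_zero],
    by rw [mul_assoc, hz.2.2, mul_zero]⟩

theorem lie_corner_zero {a z : R} (ha : a ∈ peirceCorner F e e)
    (hz : z ∈ peirceZero F e) : ⁅skewMap F R a, skewMap F R z⁆ = 0 := by
  have hz' := star_mem_peirceZero hz
  have ha' := star_mem_peirceCorner ha
  have z1 : a * z = 0 := mul_eq_zero_of_absorb ha.2 hz.1.1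
  have z2 : a * star z = 0 := mul_eq_zero_of_absorb ha.2 hz'.1.1
  have z3 : star a * z = 0 := mul_eq_zero_of_absorb ha'.2 hz.1.2
  have z4 : star a * star z = 0 := mul_eq_zero_of_absorb ha'.2 hz'.1.2
  have z5 : z * a = 0 := mul_eq_zero_of_absorb' hz.2.1 ha.1
  have z6 : star z * a = 0 := mul_eq_zero_of_absorb' hz'.2.1 ha.1
  have z7 : z * star a = 0 := mul_eq_zero_of_absorb' hz.2.2 ha'.1
  have z8 : star z * star a = 0 := mul_eq_zero_of_absorb' hz'.2.2 ha'.1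
  simp only [commutatorLieRing_lie, skewMap_apply, mul_sub, sub_mul, z1, z2, z3, z4, z5, z6, z7,
    z8, sub_zero]

/-- Commutators of skew-symmetric elements lie in every Lie subalgebra that contains the skew
parts of `e R (1 - e - e*)` and `e* R (1 - e - e*)`. -/
theorem lie_mem_of_half_le (h : IsFullSkewIdempotent F e) (h2 : (2 : F) ≠ 0)
    (hV : peirceHalf F e ≤ halfTrace Λ e) (hW : peirceHalf F (star e) ≤ halfTrace Λ (star e))
    {x y : R} (hx : star x = -x) (hy : star y = -y) : ⁅x, y⁆ ∈ Λ := by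
  set s : Set R := skewMap F R '' peirceHalf F e ∪ skewMap F R '' peirceHalf F (star e)
  -- `Λ` may contain further elements, so it need not be normalized by the diagonal blocks. The
  -- subalgebra generated by the half components is.
  set Λ₀ := LieSubalgebra.lieSpan F R s
  have hle : Λ₀ ≤ Λ := by
    refine LieSubalgebra.lieSpan_le.2 ?_
    rintro _ (⟨v, hv, rfl⟩ | ⟨v, hv, rfl⟩)
    · exact (hV hv).2
    · exact (hW hv).2
  have hV₀ : peirceHalf F e ≤ halfTrace Λ₀ e := fun v hv =>
    ⟨hv, LieSubalgebra.subset_lieSpan (.inl ⟨v, hv, rfl⟩)⟩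
  have hW₀ : peirceHalf F (star e) ≤ halfTrace Λ₀ (star e) := fun v hv =>
    ⟨hv, LieSubalgebra.subset_lieSpan (.inr ⟨v, hv, rfl⟩)⟩
  have hcorner {a l : R} (ha : a ∈ peirceCorner F e e) (hl : l ∈ Λ₀) :
      ⁅skewMap F R a, l⁆ ∈ Λ₀ := by
    refine lie_mem_of_forall_lie_mem ?_ hl
    rintro _ (⟨v, hv, rfl⟩ | ⟨v, hv, rfl⟩)
    · rw [h.lie_corner_half ha hv]
      exact (hV₀ (corner_mul_half ha hv)).2
    · have ha' := star_mem_peirceCorner ha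
      have : skewMap F R a = -skewMap F R (star a) := by rw [skewMap_star, neg_neg]
      rw [this, neg_lie, h.conj.lie_corner_half ha' hv]
      exact neg_mem (S := LieSubalgebra F R) (hW₀ (corner_mul_half ha' hv)).2
  have hzero {z l : R} (hz : z ∈ peirceZero F e) (hl : l ∈ Λ₀) :
      ⁅skewMap F R z, l⁆ ∈ Λ₀ := by
    have hz' := star_mem_peirceZero hz
    refine lie_mem_of_forall_lie_mem ?_ hl
    rintro _ (⟨v, hv, rfl⟩ | ⟨v, hv, rfl⟩)
    · rw [h.lie_zero_half hz hv]
      exact sub_mem (S := LieSubalgebra F R) (hV₀ (half_mul_zero hv hz')).2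
        (hV₀ (half_mul_zero hv hz)).2
    · rw [h.conj.lie_zero_half (peirceZero_le_star hz) hv]
      exact sub_mem (S := LieSubalgebra F R)
        (hW₀ (half_mul_zero hv (peirceZero_le_star hz'))).2
        (hW₀ (half_mul_zero hv (peirceZero_le_star hz))).2
  have hskew {x : R} (hx : star x = -x) : (2 : F)⁻¹ • skewMap F R x = x := by
    rw [skewMap_apply, hx, sub_neg_eq_add, ← two_smul F, smul_smul, inv_mul_cancel₀ h2, one_smul]
  have hxA : x ∈ Λ₀.toSubmodule ⊔ (peirceCorner F e e).map (skewMap F R) := by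
    rw [← hskew hx]
    exact Submodule.smul_mem _ _ (h.skewMap_mem_of_corner hV₀ hW₀ le_sup_left
      (fun a ha => Submodule.mem_sup_right (Submodule.mem_map_of_mem ha)) x)
  have hyZ : y ∈ Λ₀.toSubmodule ⊔ (peirceZero F e).map (skewMap F R) := by
    rw [← hskew hy]
    exact Submodule.smul_mem _ _ (h.skewMap_mem_of_zero hV₀ hW₀ le_sup_left
      (fun a ha => Submodule.mem_sup_right (Submodule.mem_map_of_mem ha)) y)
  -- Writing x with a corner remainder and y with a zero remainder leaves no bracket between
  -- remainders, since these blocks annihilate each other.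
  obtain ⟨l, hl, _, ⟨a, ha, rfl⟩, rfl⟩ := Submodule.mem_sup.1 hxA
  obtain ⟨l', hl', _, ⟨z, hz, rfl⟩, rfl⟩ := Submodule.mem_sup.1 hyZ
  apply hle
  rw [lie_add, add_lie, add_lie, lie_corner_zero ha hz, add_zero,
    ← lie_skew l (skewMap F R z)]
  exact add_mem (add_mem (Λ₀.lie_mem hl hl') (hcorner ha hl')) (neg_mem (hzero hz hl))

end IsFullSkewIdempotent

end Derived

/-! ### Conclusion, with the filter of finite subsets of [K,K]. -/

theorem theorem2 {F : Type*} [Field F] [StarRing F] [TrivialStar F] (hF : ringChar F ≠ 2)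
    {R : Type*} [NonUnitalRing R] [StarRing R] [Module F R] [IsScalarTower F R R]
    [SMulCommClass F R R] [StarModule F R]
    (hR : IsFinGenAlgebra F R)
    (e : R) (he : e * e = e) (he₁ : e * star e = 0) (he₂ : star e * e = 0)
    -- `R e R = R`
    (h₁ : Submodule.span F {x : R | ∃ a b : R, x = a * e * b} = ⊤)
    -- `R (1 - e - e*) R = R`, where `a (1 - e - e*) b = a b - a e b - a e* b`
    (h₂ : Submodule.span F {x : R | ∃ a b : R, x = a * b - a * e * b - a * star e * b} = ⊤) :
    IsFinGenLieAlgebra F (derivedLieIdeal F (skewLieSubalgebra F R)) := by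
  have h : IsFullSkewIdempotent F e := ⟨he, he₁, he₂, h₁, h₂⟩
  have h2 : (2 : F) ≠ 0 := Ring.two_ne_zero hF
  let D := derivedLieIdeal F (skewLieSubalgebra F R)
  let φ : D →ₗ⁅F⁆ R := (skewLieSubalgebra F R).incl.comp D.incl
  have hφ : Function.Injective φ := fun x y hxy => Subtype.ext (Subtype.ext hxy)
  -- Generation takes place inside [K,K] and is then pushed to R, where the Peirce computations
  -- live; injectivity of `φ` brings the result back.
  let Λ : Finset D → LieSubalgebra F R := fun S => (LieSubalgebra.lieSpan F D (S : Set D)).map φ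
  have hl : EventuallyContainsBrackets Filter.atTop Λ := by
    intro x y hx hy
    let x' : skewLieSubalgebra F R := ⟨x, hx⟩
    let y' : skewLieSubalgebra F R := ⟨y, hy⟩
    have hxy : ⁅x', y'⁆ ∈ D :=
      LieSubmodule.lie_mem_lie (LieSubmodule.mem_top x') (LieSubmodule.mem_top y')
    filter_upwards [Filter.eventually_ge_atTop {(⟨_, hxy⟩ : D)}] with S hS
    exact ⟨⟨_, hxy⟩, LieSubalgebra.subset_lieSpan (hS (Finset.mem_singleton_self _)), rfl⟩
  obtain ⟨S, hV, hW⟩ := ((h.eventually_half_le h2 hR hl).and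
    (h.conj.eventually_half_le h2 hR hl)).exists
  refine ⟨S, eq_top_iff.2 fun d _ => ?_⟩
  have hd : φ d ∈ Λ S := by
    have hmem : (d : skewLieSubalgebra F R) ∈ Submodule.span F
        {m | ∃ x : (⊤ : LieIdeal F (skewLieSubalgebra F R)),
          ∃ y : (⊤ : LieIdeal F (skewLieSubalgebra F R)), ⁅(x : skewLieSubalgebra F R),
            (y : skewLieSubalgebra F R)⁆ = m} := by
      rw [← LieSubmodule.lieIdeal_oper_eq_linear_span]
      exact d.2
    have key : ∀ k : skewLieSubalgebra F R, k ∈ Submodule.span F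
        {m | ∃ x : (⊤ : LieIdeal F (skewLieSubalgebra F R)),
          ∃ y : (⊤ : LieIdeal F (skewLieSubalgebra F R)), ⁅(x : skewLieSubalgebra F R),
            (y : skewLieSubalgebra F R)⁆ = m} → (k : R) ∈ Λ S := by
      intro k hk
      induction hk using Submodule.span_induction with
      | mem k hk =>
        obtain ⟨x, y, rfl⟩ := hk
        exact h.lie_mem_of_half_le h2 hV hW x.1.2 y.1.2
      | zero => exact zero_mem _
      | add x y _ _ hx hy => exact add_mem hx hy
      | smul c x _ hx => exact (Λ S).smul_mem c hx
    exact key d hmem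
  obtain ⟨d', hd', hdd⟩ := hd
  rwa [← hφ hdd]
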